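/- Let $G$ be a simple graph with $n\ge 1$ vertices, listed in an order $(v_1,\dots,v_n)$. For $i\le j$, the local degree of $v_j$ at stage $i$ is the number of $h<i$ with $v_h\sim v_j$. The order is called greedy (a maximum cardinality search order) if for all $i\le j$ the local degree of $v_i$ at stage $i$ is at least the local degree of $v_j$ at stage $i$. For each $j$ let $W_j$ be the list of the vertices $v_i$ with $i<j$ and $v_i\not\sim v_j$. Uniform LSS in $\mathbb{R}^d$ chooses random vectors $\varphi(v_1),\dots,\varphi(v_n)\in\mathbb{R}^d$ one after the other. Let $S_j$ be the orthogonal complement of the span of the vectors representing $W_j$. If the vectors representing $W_j$ are linearly independent, then, conditionally on $\varphi(v_1),\dots,\varphi(v_{j-1})$, the vector $\varphi(v_j)$ is drawn from a probability law on $S_j$ that gives no mass to any measurable subset of $\mathbb{R}^d$ that is closed under multiplication by positive scalars and whose intersection with $S_j$ is null for Lebesgue measure on $S_j$ (for example the uniform distribution on the unit sphere of $S_j$ if $S_j\neq 0$, or any law that is absolutely continuous with respect to Lebesgue measure on $S_j$; if $S_j=0$ then $\varphi(v_j)=0$). If the vectors representing $W_j$ are linearly dependent, then $\varphi(v_j)=0$.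 Uniform LSS in $\mathbb{R}^d$ succeeds weakly if, with probability $1$, for every $j$ one has $|W_j|<d$ and the vectors representing $W_j$ are linearly independent. It succeeds strongly if it succeeds weakly and, for all $i<j$ with $v_i\sim v_j$, with probability $1$ the vectors representing the list $W_j$ extended by $v_i$ are linearly independent. Theorem. Let the order $(v_1,\dots,v_n)$ be greedy and let $d=n-\deg(v_n)$. Then uniform LSS on $(v_1,\dots,v_n)$ in $\mathbb{R}^d$ succeeds strongly, for every admissible choice of the laws above. Moreover, with probability $1$, every $\varphi(v_j)$ is nonzero and $\varphi$ is a faithful orthogonal representation of $G$, that is, for all $i\ne j$, $\langle\varphi(v_i),\varphi(v_j)\rangle=0$ if and only if $v_i\not\sim v_j$. -/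

import Mathlib

open MeasureTheory ProbabilityTheory

namespace UniformLSS

variable {V : Type*} {n d : ℕ}

/-- The local degree of `v j` at stage `i`: the number of edges of `G` between `v j` and the
vertices that come strictly before position `i` in the ordering `v`. -/
noncomputable def localDegree (G : SimpleGraph V) (v : Fin n ≃ V) (i j : Fin n) : ℕ :=
  {h : Fin n | h < i ∧ G.Adj (v h) (v j)}.ncard

/-- A greedy (maximum cardinality search) ordering: at every stage `i` the vertex `v i` has the
largest number of neighbours among the vertices already visited. -/
def IsGreedyOrdering (G : SimpleGraph V) (v : Fin n ≃ V) : Prop :=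
  ∀ i j : Fin n, i ≤ j → localDegree G v i j ≤ localDegree G v i i

/-- The positions `i < j` of the vertices that come before `v j` and are not adjacent to it
(the list `W_j`). -/
def W (G : SimpleGraph V) (v : Fin n ≃ V) (j : Fin n) : Set (Fin n) :=
  {i : Fin n | i < j ∧ ¬ G.Adj (v i) (v j)}

/-- The subspace `S_j` of the vectors orthogonal to all vectors that represent `W_j`. -/
noncomputable def S (G : SimpleGraph V) (v : Fin n ≃ V)
    (φ : Fin n → EuclideanSpace ℝ (Fin d)) (j : Fin n) :
    Submodule ℝ (EuclideanSpace ℝ (Fin d)) :=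
  (Submodule.span ℝ (φ '' W G v j))ᗮ

/-- `ν` is an admissible law for a random choice of a vector of the subspace `U`: it is a
probability measure carried by `U`, and the direction of the chosen vector is generic, i.e. `ν`
gives no mass to a measurable positive cone whose trace on `U` is null for Haar measure of `U`.
(Null sets of Haar measure do not depend on the basis used to normalise it.)
The uniform distribution on the unit sphere of `U` has this property, and so has every
probability measure that is absolutely continuous with respect to Lebesgue measure on `U`.
If `U = ⊥` the only admissible law is the point mass at `0`. -/
def IsGenericLaw (U : Submodule ℝ (EuclideanSpace ℝ (Fin d)))
    (ν : Measure (EuclideanSpace ℝ (Fin d))) : Prop :=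
  IsProbabilityMeasure ν ∧ (∀ᵐ x ∂ν, x ∈ U) ∧
    ∀ A : Set (EuclideanSpace ℝ (Fin d)), MeasurableSet A →
      (∀ c : ℝ, 0 < c → ∀ x ∈ A, c • x ∈ A) →
      (Module.finBasis ℝ U).addHaar {u : U | (u : EuclideanSpace ℝ (Fin d)) ∈ A} = 0 →
      ν A = 0

/-- The vectors chosen before stage `j`. -/
def past (j : Fin n) (φ : Fin n → EuclideanSpace ℝ (Fin d)) :
    Set.Iio j → EuclideanSpace ℝ (Fin d) :=
  fun i => φ i

/-- `P` is the joint law of the vectors `φ 0, …, φ (n - 1)` (where `φ j` represents `v j`)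
produced by uniform LSS in `ℝ^d` for the ordering `v`.  For every `j`, given the vectors chosen
before, `φ j` is drawn from an admissible law on `S_j` if the vectors that represent `W_j` are
linearly independent, and `φ j` is the zero vector otherwise. -/
def IsUniformLSS (G : SimpleGraph V) (v : Fin n ≃ V)
    (P : Measure (Fin n → EuclideanSpace ℝ (Fin d))) [IsProbabilityMeasure P] : Prop :=
  ∀ j : Fin n, ∀ᵐ φ ∂P,
    (LinearIndepOn ℝ φ (W G v j) →
      IsGenericLaw (S G v φ j) (condDistrib (fun ψ => ψ j) (past j) P (past j φ))) ∧
    (¬ LinearIndepOn ℝ φ (W G v j) →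
      condDistrib (fun ψ => ψ j) (past j) P (past j φ) = Measure.dirac 0)

/-- Uniform LSS succeeds weakly in `ℝ^d`: with probability `1`, for every `j`, one has
`|W_j| < d` and the vectors that represent `W_j` are linearly independent. -/
def SucceedsWeakly (G : SimpleGraph V) (v : Fin n ≃ V) (d : ℕ) : Prop :=
  ∀ (P : Measure (Fin n → EuclideanSpace ℝ (Fin d))) [IsProbabilityMeasure P],
    IsUniformLSS G v P →
      ∀ᵐ φ ∂P, ∀ j : Fin n, (W G v j).ncard < d ∧ LinearIndepOn ℝ φ (W G v j)

/-- Uniform LSS succeeds strongly in `ℝ^d`: it succeeds weakly and, for all `i < j` with `v i`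
adjacent to `v j`, with probability `1` the vectors that represent the list `W_j` extended
by `v i` are linearly independent. -/
def SucceedsStrongly (G : SimpleGraph V) (v : Fin n ≃ V) (d : ℕ) : Prop :=
  SucceedsWeakly G v d ∧
  ∀ (P : Measure (Fin n → EuclideanSpace ℝ (Fin d))) [IsProbabilityMeasure P],
    IsUniformLSS G v P →
      ∀ i j : Fin n, i < j → G.Adj (v i) (v j) →
        ∀ᵐ φ ∂P, LinearIndepOn ℝ φ (insert i (W G v j))

/-- A faithful orthogonal representation: distinct vertices are represented by orthogonal
vectors exactly when they are not adjacent. -/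
def IsFaithfulOrthogonalRepresentation (G : SimpleGraph V)
    (f : V → EuclideanSpace ℝ (Fin d)) : Prop :=
  ∀ x y : V, x ≠ y → (inner ℝ (f x) (f y) = 0 ↔ ¬ G.Adj x y)

end UniformLSS

open scoped ContDiff

namespace UniformLSS

/-! ### Zero sets of real-analytic functions -/

section Analytic

/-! The random construction is compared with sequential representations: families in which each
vector is orthogonal to its list and each list is independent. Projecting the vectors of an
arbitrary family one after the other, without denominators (`scaledProj`, `projTail`), is a
polynomial map, and on sequential representations it only rescales vectors by positive factors. So
these representations behave like an irreducible variety (`seqRep_inter_nonempty`): two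
scale-invariant conditions, each the nonvanishing of an analytic function, hold together somewhere
as soon as each holds somewhere. The same parametrization shows that such a condition on the first
`k` vectors, once it holds for one sequential representation, holds almost surely (`ae_exists_mem`):
at each stage the bad choices lie in the null zero set of a nonzero analytic function on `S_j`.
Probability is thereby reduced to the existence of examples.

Greediness means `|W_i| ≤ |W_j ∩ {h < i}|` for `i ≤ j`, and `seqRep_linearIndepOn_nonempty` builds
examples for every set `A` with this domination property and `|A| ≤ d`, by induction on the number
of vectors. The crux is a last index `k ∈ A`. With `A' = A \ {k}` one needs a vector of `W_k^⊥`
outside `span A'`, that is, `A'^⊥ ⊄ span W_k`. In dimension `|A'| ≥ |W_k|` some representation has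
`W_k` independent and `A'` a basis, so the Gram matrix between `W_k` and `A'` has full row rank.
This survives an isometric embedding into `ℝ^d`, where `A'^⊥ ≠ 0` because `|A'| < d`.

Finally `|W_j| ≤ d - 1` for all `j`, which leaves room for one more vector in the strong statement.
-/

theorem ae_ne_zero_of_contDiff_real {f : ℝ → ℝ} (hf : ContDiff ℝ ω f) {x : ℝ} (hx : f x ≠ 0) :
    ∀ᵐ t : ℝ, f t ≠ 0 := by
  have hf' : AnalyticOnNhd ℝ f Set.univ :=
    (contDiff_omega_iff_analyticOnNhd (𝕜 := ℝ)).1 hf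
  rcases hf'.eqOn_zero_or_eventually_ne_zero_of_preconnected isPreconnected_univ with h | h
  · exact absurd (h (Set.mem_univ x)) hx
  · have := ae_restrict_le_codiscreteWithin (μ := (volume : Measure ℝ)) MeasurableSet.univ h
    rwa [Measure.restrict_univ] at this

/-- The zero set of a nonzero real-analytic function on a finite-dimensional space is null. -/
theorem ae_ne_zero_of_contDiff {F : Type*} [NormedAddCommGroup F] [NormedSpace ℝ F]
    [FiniteDimensional ℝ F] [MeasurableSpace F] [BorelSpace F] (μ : Measure F)
    [μ.IsAddHaarMeasure] {g : F → ℝ} (hg : ContDiff ℝ ω g) {x : F} (hx : g x ≠ 0) :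
    ∀ᵐ y ∂μ, g y ≠ 0 := by
  have hmeas : MeasurableSet {p : ℝ × F | g (x + p.1 • p.2) ≠ 0} := by
    have hc : Continuous fun p : ℝ × F => g (x + p.1 • p.2) := by
      have := hg.continuous
      fun_prop
    exact (isOpen_ne_fun hc continuous_const).measurableSet
  -- On each line through `x` the function is nonzero at `t = 0`, hence at almost every `t`. Fubini
  -- gives one `t ≠ 0` that works for almost every direction `y`, and the affine map `y ↦ x + t • y`
  -- preserves null sets.
  have h1 : ∀ y : F, ∀ᵐ t : ℝ, g (x + t • y) ≠ 0 := by
    intro y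
    refine ae_ne_zero_of_contDiff_real (f := fun t : ℝ => g (x + t • y)) (x := 0) ?_ (by simpa)
    exact hg.comp (by fun_prop : ContDiff ℝ ω fun t : ℝ => x + t • y)
  have h2 : ∀ᵐ t : ℝ, ∀ᵐ y ∂μ, g (x + t • y) ≠ 0 :=
    (Measure.ae_ae_comm (μ := volume) (ν := μ) hmeas).2 (Filter.Eventually.of_forall h1)
  have h3 : ∀ᵐ t : ℝ, t ≠ 0 := by simp [ae_iff]
  obtain ⟨t, ht, ht0⟩ := (h2.and h3).exists
  rw [ae_iff] at ht ⊢
  simp only [not_not] at ht ⊢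
  have hset : {y | g (x + t • y) = 0} = (fun y => t • y) ⁻¹' ((fun y => x + y) ⁻¹' {y | g y = 0}) :=
    rfl
  rw [hset, Measure.addHaar_preimage_smul μ ht0, measure_preimage_add] at ht
  simpa [ht0] using ht

/-- On the line joining `x` to `y` both functions are analytic and not identically zero, so almost
every point of it works. The dimension of `F` plays no role. -/
theorem exists_ne_zero_of_contDiff {F : Type*} [NormedAddCommGroup F] [NormedSpace ℝ F]
    {f g : F → ℝ} (hf : ContDiff ℝ ω f) (hg : ContDiff ℝ ω g)
    {x y : F} (hx : f x ≠ 0) (hy : g y ≠ 0) : ∃ z, f z ≠ 0 ∧ g z ≠ 0 := by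
  have hl : ContDiff ℝ ω fun t : ℝ => x + t • (y - x) := by fun_prop
  have h1 := ae_ne_zero_of_contDiff_real (hf.comp hl) (x := 0) (by simpa)
  have h2 := ae_ne_zero_of_contDiff_real (hg.comp hl) (x := 1) (by simpa)
  obtain ⟨t, ht⟩ := (h1.and h2).exists
  exact ⟨_, ht⟩

theorem contDiff_det {F : Type*} [NormedAddCommGroup F] [NormedSpace ℝ F]
    {ι : Type*} [Fintype ι] [DecidableEq ι] {M : F → Matrix ι ι ℝ}
    (h : ∀ i j, ContDiff ℝ ω fun x => M x i j) : ContDiff ℝ ω fun x => (M x).det := by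
  simp only [Matrix.det_apply]
  fun_prop

end Analytic

/-! ### Orthogonal projection without denominators -/

section ScaledProj

variable {E : Type*} [NormedAddCommGroup E] [InnerProductSpace ℝ E]
  {ι : Type*} [Fintype ι] [DecidableEq ι]

/-- The orthogonal projection of `q` to the complement of the span of `w`, multiplied by the
Gram determinant of `w`, written as a polynomial in `w` and `q`. -/
noncomputable def scaledProj (w : ι → E) (q : E) : E :=
  (Matrix.gram ℝ w).det • q -
    ∑ i, ((Matrix.gram ℝ w).adjugate.mulVec fun j => inner ℝ (w j) q) i • w i

/-- This is the identity `G * adj G = det G` for the Gram matrix `G`, so it holds even when `w` is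
dependent. -/
theorem inner_scaledProj (w : ι → E) (q : E) (l : ι) : inner ℝ (w l) (scaledProj w q) = 0 := by
  have h : ∑ i, ((Matrix.gram ℝ w).adjugate.mulVec fun j => inner ℝ (w j) q) i *
      inner ℝ (w l) (w i) = ((Matrix.gram ℝ w).mulVec
        ((Matrix.gram ℝ w).adjugate.mulVec fun j => inner ℝ (w j) q)) l := by
    simp only [Matrix.mulVec, dotProduct, Matrix.gram_apply]
    exact Finset.sum_congr rfl fun _ _ => mul_comm _ _
  rw [scaledProj, inner_sub_right, inner_sum, inner_smul_right]
  simp only [inner_smul_right]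
  rw [h, Matrix.mulVec_mulVec, Matrix.mul_adjugate, Matrix.smul_mulVec, Matrix.one_mulVec]
  simp

theorem scaledProj_of_orthogonal {w : ι → E} {q : E} (h : ∀ i, inner ℝ (w i) q = 0) :
    scaledProj w q = (Matrix.gram ℝ w).det • q := by
  have : (fun j => inner ℝ (w j) q) = 0 := funext h
  simp [scaledProj, this]

/-- Rescaling `w` turns `G` into `D G D` with `D` diagonal. The common factor is positive when `c`
and `a` are, so scale-invariant conditions can be pulled back along the projection. -/
theorem scaledProj_smul (w : ι → E) (q : E) (c : ι → ℝ) (a : ℝ) :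
    scaledProj (fun i => c i • w i) (a • q) = ((∏ i, c i) ^ 2 * a) • scaledProj w q := by
  have hg : Matrix.gram ℝ (fun i => c i • w i) =
      Matrix.diagonal c * Matrix.gram ℝ w * Matrix.diagonal c := by
    ext i j
    simp [Matrix.diagonal_mul, Matrix.mul_diagonal, inner_smul_left, inner_smul_right]
    ring
  have he : ∀ i, (∏ j ∈ Finset.univ.erase i, c j) * c i = ∏ j, c j := fun i =>
    Finset.prod_erase_mul _ _ (Finset.mem_univ i)
  have hv : ∀ i, ((Matrix.gram ℝ fun i => c i • w i).adjugate.mulVec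
      fun j => inner ℝ (c j • w j) (a • q)) i * c i =
      ((∏ i, c i) ^ 2 * a) *
        ((Matrix.gram ℝ w).adjugate.mulVec fun j => inner ℝ (w j) q) i := by
    intro i
    simp only [hg, Matrix.adjugate_mul_distrib, Matrix.adjugate_diagonal, Matrix.mulVec,
      dotProduct, Finset.sum_mul, Finset.mul_sum]
    refine Finset.sum_congr rfl fun j _ => ?_
    rw [← mul_assoc (Matrix.diagonal _), Matrix.mul_diagonal, Matrix.diagonal_mul,
      inner_smul_left, inner_smul_right]
    simp only [conj_trivial]
    -- One of the two factors `∏ c` is split at `i`, the other at `j`, to match the entries of the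
    -- two diagonal adjugates.
    rw [sq, ← he i]
    nth_rewrite 2 [he i]
    rw [← he j]
    ring
  rw [scaledProj, scaledProj, smul_sub, hg, Matrix.det_mul, Matrix.det_mul, Matrix.det_diagonal,
    ← hg, Finset.smul_sum]
  congr 1
  · rw [smul_smul, smul_smul]
    congr 1
    ring
  · refine Finset.sum_congr rfl fun i _ => ?_
    rw [smul_smul, smul_smul, hv]

theorem contDiff_scaledProj {F : Type*} [NormedAddCommGroup F] [NormedSpace ℝ F]
    {w : F → ι → E} {q : F → E} (hw : ∀ i, ContDiff ℝ ω fun x => w x i) (hq : ContDiff ℝ ω q) :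
    ContDiff ℝ ω fun x => scaledProj (w x) (q x) := by
  have hG : ∀ i j, ContDiff ℝ ω fun x => (Matrix.gram ℝ (w x)) i j := fun i j =>
    (hw i).inner ℝ (hw j)
  have hadj : ∀ i j, ContDiff ℝ ω fun x => (Matrix.gram ℝ (w x)).adjugate i j := by
    intro i j
    simp only [Matrix.adjugate_apply]
    refine contDiff_det fun k l => ?_
    by_cases h : k = j
    · subst h
      simp only [Matrix.updateRow_self]
      exact contDiff_const
    · simp only [Matrix.updateRow_ne h]
      exact hG k l
  have hdet := contDiff_det hG
  have hin : ∀ j, ContDiff ℝ ω fun x => inner ℝ (w x j) (q x) := fun j => (hw j).inner ℝ hq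
  simp only [scaledProj, Matrix.mulVec, dotProduct]
  fun_prop

end ScaledProj

/-! ### Scale-invariant generic conditions -/

section GenericSets

variable {E : Type*} [NormedAddCommGroup E] [InnerProductSpace ℝ E] {n : ℕ}

/-- The nonvanishing locus of a real-analytic function, invariant under rescaling each of the
vectors by a positive factor. -/
structure IsGenericSet (C : Set (Fin n → E)) : Prop where
  exists_contDiff : ∃ g : (Fin n → E) → ℝ, ContDiff ℝ ω g ∧ ∀ φ, φ ∈ C ↔ g φ ≠ 0
  smul_mem : ∀ c : Fin n → ℝ, (∀ i, 0 < c i) → ∀ φ ∈ C, (fun i => c i • φ i) ∈ C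

theorem IsGenericSet.inter {C D : Set (Fin n → E)} (hC : IsGenericSet C) (hD : IsGenericSet D) :
    IsGenericSet (C ∩ D) := by
  obtain ⟨⟨f, hf, hfC⟩, hC⟩ := hC
  obtain ⟨⟨g, hg, hgD⟩, hD⟩ := hD
  refine ⟨⟨fun φ => f φ * g φ, hf.mul hg, fun φ => ?_⟩, fun c hc φ h =>
    ⟨hC c hc φ h.1, hD c hc φ h.2⟩⟩
  rw [mul_ne_zero_iff, ← hfC, ← hgD, Set.mem_inter_iff]

theorem IsGenericSet.univ : IsGenericSet (Set.univ : Set (Fin n → E)) :=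
  ⟨⟨fun _ => 1, contDiff_const, by simp⟩, by simp⟩

theorem IsGenericSet.isOpen {C : Set (Fin n → E)} (hC : IsGenericSet C) : IsOpen C := by
  obtain ⟨⟨g, hg, hgC⟩, -⟩ := hC
  have : C = {φ | g φ ≠ 0} := Set.ext hgC
  rw [this]
  exact isOpen_ne_fun hg.continuous continuous_const

theorem linearIndepOn_finset_iff_det_gram {φ : Fin n → E} {A : Finset (Fin n)} :
    LinearIndepOn ℝ φ (A : Set (Fin n)) ↔ (Matrix.gram ℝ fun i : A => φ i).det ≠ 0 :=
  Matrix.det_gram_ne_zero_iff_linearIndependent.symm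

theorem linearIndepOn_smul {φ : Fin n → E} {A : Set (Fin n)} {c : Fin n → ℝ}
    (hc : ∀ i, 0 < c i) (h : LinearIndepOn ℝ φ A) : LinearIndepOn ℝ (fun i => c i • φ i) A :=
  LinearIndependent.units_smul h fun i => Units.mk0 (c i) (hc i).ne'

theorem isGenericSet_linearIndepOn (A : Finset (Fin n)) :
    IsGenericSet {φ : Fin n → E | LinearIndepOn ℝ φ (A : Set (Fin n))} :=
  ⟨⟨fun φ => (Matrix.gram ℝ fun i : A => φ i).det,
    contDiff_det fun i j => ContDiff.inner ℝ (by fun_prop) (by fun_prop),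
    fun _ => linearIndepOn_finset_iff_det_gram⟩, fun _ hc _ h => linearIndepOn_smul hc h⟩

theorem isGenericSet_ne_zero (i : Fin n) : IsGenericSet {φ : Fin n → E | φ i ≠ 0} :=
  ⟨⟨fun φ => inner ℝ (φ i) (φ i), ContDiff.inner ℝ (by fun_prop) (by fun_prop), by simp⟩,
    fun c hc φ h => by simpa [(hc i).ne'] using h⟩

theorem isGenericSet_inner_ne_zero (i j : Fin n) :
    IsGenericSet {φ : Fin n → E | inner ℝ (φ i) (φ j) ≠ 0} :=
  ⟨⟨fun φ => inner ℝ (φ i) (φ j), ContDiff.inner ℝ (by fun_prop) (by fun_prop), by simp⟩,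
    fun c hc φ h => by
      simpa [inner_smul_left, inner_smul_right, (hc i).ne', (hc j).ne'] using h⟩

theorem span_image_smul (φ : Fin n → E) (A : Set (Fin n)) {c : Fin n → ℝ} (hc : ∀ i, 0 < c i) :
    Submodule.span ℝ ((fun i => c i • φ i) '' A) = Submodule.span ℝ (φ '' A) := by
  refine le_antisymm (Submodule.span_le.2 ?_) (Submodule.span_le.2 ?_)
  · rintro _ ⟨i, hi, rfl⟩
    exact Submodule.smul_mem _ _ (Submodule.subset_span ⟨i, hi, rfl⟩)
  · rintro _ ⟨i, hi, rfl⟩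
    have h : c i • φ i ∈ Submodule.span ℝ ((fun i => c i • φ i) '' A) :=
      Submodule.subset_span ⟨i, hi, rfl⟩
    have := Submodule.smul_mem _ (c i)⁻¹ h
    rwa [smul_smul, inv_mul_cancel₀ (hc i).ne', one_smul] at this

/-- The frame operator of the vectors `φ a` with `a ∈ A`. -/
noncomputable def frameOp (φ : Fin n → E) (A : Finset (Fin n)) : E →ₗ[ℝ] E where
  toFun x := ∑ a ∈ A, inner ℝ (φ a) x • φ a
  map_add' x y := by simp [inner_add_right, add_smul, Finset.sum_add_distrib]
  map_smul' c x := by simp [inner_smul_right, Finset.smul_sum, smul_smul]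

/-- The pairing of `frameOp φ A x` with `x` is the sum of squares of the `⟪φ a, x⟫`. -/
theorem ker_frameOp (φ : Fin n → E) (A : Finset (Fin n)) :
    LinearMap.ker (frameOp φ A) = (Submodule.span ℝ (φ '' A))ᗮ := by
  ext x
  rw [LinearMap.mem_ker, Submodule.mem_orthogonal]
  constructor
  · intro h
    have h0 : ∑ a ∈ A, inner ℝ (φ a) x ^ 2 = 0 := by
      have : inner ℝ (frameOp φ A x) x = 0 := by rw [h, inner_zero_left]
      rw [← this]
      simp [frameOp, sum_inner, inner_smul_left, sq]
    rw [Finset.sum_eq_zero_iff_of_nonneg fun _ _ => sq_nonneg _] at h0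
    intro u hu
    induction hu using Submodule.span_induction with
    | mem u hu =>
      obtain ⟨a, ha, rfl⟩ := hu
      exact pow_eq_zero_iff two_ne_zero |>.1 (h0 a ha)
    | zero => simp
    | add u v _ _ hu hv => rw [inner_add_left, hu, hv, add_zero]
    | smul c u _ hu => rw [inner_smul_left, hu, mul_zero]
  · intro h
    refine Finset.sum_eq_zero fun a ha => ?_
    rw [h _ (Submodule.subset_span ⟨a, ha, rfl⟩), zero_smul]

/-- The Gram matrix between the rows `B` and the columns `A` has full row rank. -/
def GramIndep (φ : Fin n → E) (B A : Finset (Fin n)) : Prop :=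
  LinearIndepOn ℝ φ (B : Set (Fin n)) ∧
    Disjoint (Submodule.span ℝ (φ '' B)) (Submodule.span ℝ (φ '' A))ᗮ

/-- A linear map keeps a family independent exactly when the family is independent and its span
meets the kernel trivially. The rank of a rectangular Gram matrix thus becomes the nonvanishing of a
single determinant. -/
theorem gramIndep_iff {φ : Fin n → E} {B A : Finset (Fin n)} :
    GramIndep φ B A ↔ LinearIndepOn ℝ (fun i => frameOp φ A (φ i)) (B : Set (Fin n)) := by
  rw [GramIndep, ← ker_frameOp, Set.image_eq_range]
  constructor
  · rintro ⟨h1, h2⟩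
    exact LinearIndependent.map (v := fun i : (B : Set (Fin n)) => φ i) h1 h2
  · intro h
    exact ⟨LinearIndependent.of_comp (frameOp φ A) h,
      Submodule.range_ker_disjoint h⟩

theorem isGenericSet_gramIndep (B A : Finset (Fin n)) :
    IsGenericSet {φ : Fin n → E | GramIndep φ B A} := by
  refine ⟨⟨fun φ => (Matrix.gram ℝ fun i : B => frameOp φ A (φ i)).det, ?_, fun φ => ?_⟩, ?_⟩
  · have h : ∀ i, ContDiff ℝ ω fun φ : Fin n → E => frameOp φ A (φ i) := by
      intro i
      refine ContDiff.sum fun a _ => ContDiff.smul (ContDiff.inner ℝ ?_ ?_) ?_ <;> fun_prop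
    exact contDiff_det fun i j => (h i).inner ℝ (h j)
  · rw [Set.mem_ofPred_eq, gramIndep_iff]
    exact Matrix.det_gram_ne_zero_iff_linearIndependent.symm
  · rintro c hc φ ⟨h1, h2⟩
    refine ⟨linearIndepOn_smul hc h1, ?_⟩
    rwa [span_image_smul φ _ hc, span_image_smul φ _ hc]

end GenericSets

/-! ### Irreducibility of the space of sequential representations -/

section SequentialRepresentations

variable {E : Type*} [NormedAddCommGroup E] [InnerProductSpace ℝ E] {n : ℕ}
  (W : Fin n → Finset (Fin n))

/-- The first `k` vectors form a sequential representation: each of them is orthogonal to the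
vectors of its list, and the latter are linearly independent. -/
def seqRep (E : Type*) [NormedAddCommGroup E] [InnerProductSpace ℝ E] (k : ℕ) :
    Set (Fin n → E) :=
  {φ | ∀ i : Fin n, (i : ℕ) < k →
    (∀ h ∈ W i, inner ℝ (φ h) (φ i) = 0) ∧ LinearIndepOn ℝ φ (W i : Set (Fin n))}

variable {W} in
theorem seqRep_smul {k : ℕ} {φ : Fin n → E} (hφ : φ ∈ seqRep W E k) {c : Fin n → ℝ}
    (hc : ∀ i, 0 < c i) : (fun i => c i • φ i) ∈ seqRep W E k := fun i hi =>
  ⟨fun h hh => by simp [inner_smul_left, inner_smul_right, (hφ i hi).1 h hh],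
    linearIndepOn_smul hc (hφ i hi).2⟩

/-- Replace the vector with index `m` by its (scaled) projection to the orthogonal complement of
the vectors of its list. -/
noncomputable def projStep (m : ℕ) (φ : Fin n → E) : Fin n → E := fun j =>
  if (j : ℕ) = m then scaledProj (fun i : W j => φ i) (φ j) else φ j

/-- Apply `projStep` successively to the indices `m, m + 1, …, m + r - 1`. -/
noncomputable def projTail : ℕ → ℕ → (Fin n → E) → Fin n → E
  | 0, _, φ => φ
  | r + 1, m, φ => projTail r (m + 1) (projStep W m φ)

theorem contDiff_projStep (m : ℕ) : ContDiff ℝ ω (projStep W m : (Fin n → E) → Fin n → E) := by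
  refine contDiff_pi.2 fun j => ?_
  by_cases h : (j : ℕ) = m
  · simp only [projStep, h, if_true]
    exact contDiff_scaledProj (fun i => by fun_prop) (by fun_prop)
  · simp only [projStep, h, if_false]
    fun_prop

theorem projStep_smul (m : ℕ) {c : Fin n → ℝ} (hc : ∀ i, 0 < c i) (φ : Fin n → E) :
    ∃ c' : Fin n → ℝ, (∀ i, 0 < c' i) ∧
      projStep W m (fun i => c i • φ i) = fun i => c' i • projStep W m φ i := by
  refine ⟨fun j => if (j : ℕ) = m then (∏ i : W j, c i) ^ 2 * c j else c j, fun j => ?_, ?_⟩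
  · have := Finset.prod_pos fun (i : W j) (_ : i ∈ Finset.univ) => hc i
    have := hc j
    dsimp only
    split_ifs <;> positivity
  · funext j
    simp only [projStep]
    split_ifs
    · exact scaledProj_smul _ _ _ _
    · rfl

variable {W} in
theorem IsGenericSet.preimage_projStep {C : Set (Fin n → E)} (hC : IsGenericSet C) (m : ℕ) :
    IsGenericSet (projStep W m ⁻¹' C) := by
  obtain ⟨⟨g, hg, hgC⟩, hs⟩ := hC
  refine ⟨⟨fun φ => g (projStep W m φ), hg.comp (contDiff_projStep W m), fun φ => hgC _⟩,
    fun c hc φ hφ => ?_⟩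
  obtain ⟨c', hc', h⟩ := projStep_smul W m hc φ
  rw [Set.mem_preimage, h]
  exact hs c' hc' _ hφ

variable {W} in
theorem IsGenericSet.preimage_projTail {C : Set (Fin n → E)} (hC : IsGenericSet C) (r m : ℕ) :
    IsGenericSet (projTail W r m ⁻¹' C) := by
  induction r generalizing m with
  | zero => exact hC
  | succ r ih => exact (ih (m + 1)).preimage_projStep m

theorem projTail_apply_of_lt (r m : ℕ) (φ : Fin n → E) {j : Fin n} (hj : (j : ℕ) < m) :
    projTail W r m φ j = φ j := by
  induction r generalizing m φ with
  | zero => rfl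
  | succ r ih => rw [projTail, ih _ _ (by omega), projStep, if_neg (by omega)]

variable {W}

/-- Orthogonality is created when index `j` is treated, and later steps change neither `j` nor the
earlier `i`. -/
theorem inner_projTail (hW : ∀ j, ∀ i ∈ W j, i < j) (r m : ℕ) (φ : Fin n → E) {i j : Fin n}
    (hj : m ≤ j) (hj' : (j : ℕ) < m + r) (hi : i ∈ W j) :
    inner ℝ (projTail W r m φ i) (projTail W r m φ j) = 0 := by
  induction r generalizing m φ with
  | zero => omega
  | succ r ih =>
    rw [projTail]
    rcases hj.eq_or_lt with h | h
    · have hij : (i : ℕ) < j := hW j i hi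
      rw [projTail_apply_of_lt _ _ _ _ (by omega), projTail_apply_of_lt _ _ _ _ (by omega),
        projStep, projStep, if_neg (by omega), if_pos h.symm]
      exact inner_scaledProj (fun i : W j => φ i) (φ j) ⟨i, hi⟩
    · exact ih _ _ h (by omega)

/-- A vector already orthogonal to its list is only multiplied by the Gram determinant, which is
positive because the list is independent. -/
theorem projStep_of_mem_seqRep {k m : ℕ} (hm : m < k) {φ : Fin n → E} (hφ : φ ∈ seqRep W E k) :
    ∃ c : Fin n → ℝ, (∀ i, 0 < c i) ∧ projStep W m φ = fun i => c i • φ i := by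
  refine ⟨fun j => if (j : ℕ) = m then (Matrix.gram ℝ fun i : W j => φ i).det else 1,
    fun j => ?_, ?_⟩
  · dsimp only
    split_ifs with h
    · exact (Matrix.posDef_gram_of_linearIndependent (hφ j (by omega)).2).det_pos
    · exact one_pos
  · funext j
    simp only [projStep]
    split_ifs with h
    · exact scaledProj_of_orthogonal fun i => (hφ j (by omega)).1 i i.2
    · rw [one_smul]

theorem projTail_of_mem_seqRep {k : ℕ} (r m : ℕ) (hm : m + r ≤ k) {φ : Fin n → E}
    (hφ : φ ∈ seqRep W E k) :
    ∃ c : Fin n → ℝ, (∀ i, 0 < c i) ∧ projTail W r m φ = fun i => c i • φ i := by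
  induction r generalizing m φ with
  | zero => exact ⟨fun _ => 1, fun _ => one_pos, by simp [projTail]⟩
  | succ r ih =>
    obtain ⟨c, hc, h⟩ := projStep_of_mem_seqRep (m := m) (by omega) hφ
    obtain ⟨c', hc', h'⟩ := ih (m + 1) (by omega) (seqRep_smul hφ hc)
    refine ⟨fun i => c' i * c i, fun i => mul_pos (hc' i) (hc i), ?_⟩
    rw [projTail, h, h']
    simp only [smul_smul]

theorem IsGenericSet.projTail_mem {k : ℕ} {C : Set (Fin n → E)} (hC : IsGenericSet C)
    {φ : Fin n → E} (hφ : φ ∈ seqRep W E k) (hφC : φ ∈ C) : projTail W k 0 φ ∈ C := by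
  obtain ⟨c, hc, h⟩ := projTail_of_mem_seqRep k 0 (by omega) hφ
  rw [h]
  exact hC.smul_mem c hc φ hφC

theorem IsGenericSet.biInter {ι : Type*} (s : Finset ι) {C : ι → Set (Fin n → E)}
    (hC : ∀ i ∈ s, IsGenericSet (C i)) : IsGenericSet (⋂ i ∈ s, C i) := by
  classical
  induction s using Finset.induction_on with
  | empty => simpa using IsGenericSet.univ
  | insert a s _ ih =>
    rw [Finset.set_biInter_insert]
    exact (hC a (by simp)).inter (ih fun i hi => hC i (by simp [hi]))

theorem IsGenericSet.nonempty_inter {C D : Set (Fin n → E)} (hC : IsGenericSet C)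
    (hD : IsGenericSet D) (hCn : C.Nonempty) (hDn : D.Nonempty) : (C ∩ D).Nonempty := by
  obtain ⟨⟨f, hf, hfC⟩, -⟩ := hC
  obtain ⟨⟨g, hg, hgD⟩, -⟩ := hD
  obtain ⟨x, hx⟩ := hCn
  obtain ⟨y, hy⟩ := hDn
  obtain ⟨z, h1, h2⟩ := exists_ne_zero_of_contDiff hf hg ((hfC x).1 hx) ((hgD y).1 hy)
  exact ⟨z, (hfC z).2 h1, (hgD z).2 h2⟩

/-- The space of sequential representations is irreducible. -/
theorem seqRep_inter_nonempty (hW : ∀ j, ∀ i ∈ W j, i < j) {k : ℕ} {C D : Set (Fin n → E)}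
    (hC : IsGenericSet C) (hD : IsGenericSet D) (hCn : (seqRep W E k ∩ C).Nonempty)
    (hDn : (seqRep W E k ∩ D).Nonempty) : (seqRep W E k ∩ (C ∩ D)).Nonempty := by
  obtain ⟨φ, hφ, hφC⟩ := hCn
  obtain ⟨ψ, hψ, hψD⟩ := hDn
  -- `projTail` produces the orthogonality relations from any family, but not the independence of
  -- the lists, which is imposed as a further generic condition.
  have hI : IsGenericSet (⋂ i ∈ Finset.univ.filter fun i : Fin n => (i : ℕ) < k,
      {φ : Fin n → E | LinearIndepOn ℝ φ (W i : Set (Fin n))}) :=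
    IsGenericSet.biInter _ fun i _ => isGenericSet_linearIndepOn (W i)
  have h1 := (hC.inter hI).preimage_projTail (W := W) k 0
  have h2 := hD.preimage_projTail (W := W) k 0
  obtain ⟨χ, ⟨hχC, hχI⟩, hχD⟩ := h1.nonempty_inter h2
    ⟨φ, (hC.inter hI).projTail_mem hφ ⟨hφC, by
      simp only [Set.mem_iInter, Finset.mem_filter]
      exact fun i hi => (hφ i hi.2).2⟩⟩
    ⟨ψ, hD.projTail_mem hψ hψD⟩
  refine ⟨projTail W k 0 χ, fun i hi => ⟨fun h hh => ?_, ?_⟩, hχC, hχD⟩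
  · exact inner_projTail hW k 0 χ (by omega) (by omega) hh
  · simp only [Set.mem_iInter, Finset.mem_filter] at hχI
    exact hχI i ⟨Finset.mem_univ _, hi⟩

/-- A sequential representation can be extended by any vector orthogonal to the next list. -/
theorem update_mem_seqRep (hW : ∀ j, ∀ i ∈ W j, i < j) {k : Fin n} {φ : Fin n → E}
    (hφ : φ ∈ seqRep W E k) (hk : LinearIndepOn ℝ φ (W k : Set (Fin n))) {s : E}
    (hs : ∀ i ∈ W k, inner ℝ (φ i) s = 0) :
    Function.update φ k s ∈ seqRep W E (k + 1) := by
  intro i hi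
  have hne : ∀ h ∈ W i, h ≠ k := fun h hh => by
    have : (h : ℕ) < i := hW i h hh
    intro h'
    subst h'
    omega
  have hli : LinearIndepOn ℝ (Function.update φ k s) (W i : Set (Fin n)) ↔
      LinearIndepOn ℝ φ (W i : Set (Fin n)) :=
    linearIndepOn_congr fun h hh => Function.update_of_ne (hne h hh) _ _
  rw [hli]
  by_cases hik : i = k
  · subst hik
    refine ⟨fun h hh => ?_, hk⟩
    rw [Function.update_of_ne (hne h hh), Function.update_self]
    exact hs h hh
  · have hik' : (i : ℕ) ≠ k := fun h => hik (Fin.ext h)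
    refine ⟨fun h hh => ?_, (hφ i (by omega)).2⟩
    rw [Function.update_of_ne (hne h hh), Function.update_of_ne hik]
    exact (hφ i (by omega)).1 h hh

theorem linearIsometry_mem_seqRep {E' : Type*} [NormedAddCommGroup E'] [InnerProductSpace ℝ E']
    (f : E →ₗᵢ[ℝ] E') {k : ℕ} {φ : Fin n → E} (hφ : φ ∈ seqRep W E k) :
    (fun i => f (φ i)) ∈ seqRep W E' k := fun i hi =>
  ⟨fun h hh => by rw [f.inner_map_map]; exact (hφ i hi).1 h hh,
    LinearIndependent.map' (hφ i hi).2 f.toLinearMap (LinearMap.ker_eq_bot.2 f.injective)⟩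

theorem linearIsometry_gramIndep {E' : Type*} [NormedAddCommGroup E'] [InnerProductSpace ℝ E']
    (f : E →ₗᵢ[ℝ] E') {φ : Fin n → E} {B A : Finset (Fin n)} (h : GramIndep φ B A) :
    GramIndep (fun i => f (φ i)) B A := by
  rw [gramIndep_iff] at h ⊢
  have : (fun i => frameOp (fun i => f (φ i)) A (f (φ i))) =
      fun i => f (frameOp φ A (φ i)) := by
    funext i
    simp [frameOp, f.inner_map_map]
  rw [this]
  exact LinearIndependent.map' h f.toLinearMap (LinearMap.ker_eq_bot.2 f.injective)

end SequentialRepresentations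

/-! ### Existence of independent examples -/

section Existence

variable {n : ℕ} (W : Fin n → Finset (Fin n))

/-- `A` consists of positions before `m`, and before each position `i < m` it has at least as many
elements as the list of `i`. -/
structure Dominates (m : ℕ) (A : Finset (Fin n)) : Prop where
  lt : ∀ a ∈ A, (a : ℕ) < m
  card_le : ∀ i : Fin n, (i : ℕ) < m → (W i).card ≤ (A.filter fun a => a < i).card

variable {W}

theorem exists_linearIsometry_euclideanSpace {b d : ℕ} (h : b ≤ d) :
    Nonempty (EuclideanSpace ℝ (Fin b) →ₗᵢ[ℝ] EuclideanSpace ℝ (Fin d)) := by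
  let e := EuclideanSpace.basisFun (Fin b) ℝ
  let v : Fin b → EuclideanSpace ℝ (Fin d) := fun i => EuclideanSpace.single (Fin.castLE h i) 1
  have hv : Orthonormal ℝ v :=
    (EuclideanSpace.orthonormal_single (𝕜 := ℝ) (ι := Fin d)).comp _ (Fin.castLE_injective h)
  refine ⟨(e.toBasis.constr ℝ v).isometryOfOrthonormal (v := e.toBasis)
    (by simp) ?_⟩
  convert hv
  funext i
  simp

theorem finrank_span_image_lt {d : ℕ} (φ : Fin n → EuclideanSpace ℝ (Fin d))
    {A : Finset (Fin n)} (hA : A.card < d) :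
    Module.finrank ℝ (Submodule.span ℝ (φ '' A)) < d := by
  classical
  rw [← Finset.coe_image]
  exact (finrank_span_finset_le_card _).trans_lt (Finset.card_image_le.trans_lt hA)

theorem exists_ne_zero_mem_orthogonal {d : ℕ} (φ : Fin n → EuclideanSpace ℝ (Fin d))
    {A : Finset (Fin n)} (hA : A.card < d) :
    ∃ s ∈ (Submodule.span ℝ (φ '' A))ᗮ, s ≠ 0 := by
  refine Submodule.exists_mem_ne_zero_of_ne_bot fun h => ?_
  rw [Submodule.orthogonal_eq_bot_iff] at h
  have := finrank_span_image_lt φ hA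
  rw [h, finrank_top, finrank_euclideanSpace_fin] at this
  exact lt_irrefl _ this

theorem exists_mem_orthogonal_inner_ne_zero {E : Type*} [NormedAddCommGroup E]
    [InnerProductSpace ℝ E] [FiniteDimensional ℝ E] {U : Submodule ℝ E} {x : E} (hx : x ∉ U) :
    ∃ s ∈ Uᗮ, inner ℝ x s ≠ 0 := by
  by_contra! h
  refine hx ?_
  rw [← Submodule.orthogonal_orthogonal U, Submodule.mem_orthogonal']
  exact h

/-- Since `|A| < d`, some `x ≠ 0` is orthogonal to `A`, and then `x ∉ span B`. A vector `s`
orthogonal to `B` but not to `x` cannot lie in `span A`. -/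
theorem GramIndep.exists_notMem_span {d : ℕ} {φ : Fin n → EuclideanSpace ℝ (Fin d)}
    {A B : Finset (Fin n)} (h : GramIndep φ B A) (hA : A.card < d) :
    ∃ s ∈ (Submodule.span ℝ (φ '' B))ᗮ, s ∉ Submodule.span ℝ (φ '' A) := by
  obtain ⟨x, hx, hx0⟩ := exists_ne_zero_mem_orthogonal φ hA
  obtain ⟨s, hs, hs0⟩ := exists_mem_orthogonal_inner_ne_zero fun hxB =>
    hx0 (Submodule.disjoint_def.1 h.2 x hxB hx)
  exact ⟨s, hs, fun hsA => hs0 ((Submodule.mem_orthogonal' _ _).1 hx s hsA)⟩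

theorem gramIndep_of_card_eq {b : ℕ} {φ : Fin n → EuclideanSpace ℝ (Fin b)}
    {A B : Finset (Fin n)} (hA : LinearIndepOn ℝ φ (A : Set (Fin n))) (hb : A.card = b)
    (hB : LinearIndepOn ℝ φ (B : Set (Fin n))) : GramIndep φ B A := by
  refine ⟨hB, ?_⟩
  have h : Submodule.span ℝ (φ '' A) = ⊤ := by
    rw [Set.image_eq_range]
    exact LinearIndependent.span_eq_top_of_card_eq_finrank' hA (by simpa using hb)
  rw [h, Submodule.top_orthogonal_eq_bot]
  exact disjoint_bot_right

/-- The example is found in dimension `|A|`, where an independent `A` spans everything, and is then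
embedded isometrically. -/
theorem gramIndep_nonempty_of_forall (hW : ∀ j, ∀ i ∈ W j, i < j) {m : ℕ}
    (ih : ∀ (d : ℕ) (A : Finset (Fin n)), Dominates W m A → A.card ≤ d →
      (seqRep W (EuclideanSpace ℝ (Fin d)) m ∩
        {φ | LinearIndepOn ℝ φ (A : Set (Fin n))}).Nonempty)
    {A B : Finset (Fin n)} (hA : Dominates W m A) (hB : Dominates W m B)
    (hBA : B.card ≤ A.card) {d : ℕ} (hd : A.card ≤ d) :
    (seqRep W (EuclideanSpace ℝ (Fin d)) m ∩ {φ | GramIndep φ B A}).Nonempty := by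
  obtain ⟨φ, hφ, hφA, hφB⟩ := seqRep_inter_nonempty hW (isGenericSet_linearIndepOn A)
    (isGenericSet_linearIndepOn B) (ih A.card A hA le_rfl) (ih A.card B hB hBA)
  obtain ⟨f⟩ := exists_linearIsometry_euclideanSpace hd
  exact ⟨fun i => f (φ i), linearIsometry_mem_seqRep f hφ,
    linearIsometry_gramIndep f (gramIndep_of_card_eq hφA rfl hφB)⟩

theorem inner_eq_zero_of_mem_orthogonal_span {E : Type*} [NormedAddCommGroup E]
    [InnerProductSpace ℝ E] {φ : Fin n → E} {A : Finset (Fin n)} {s : E}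
    (hs : s ∈ (Submodule.span ℝ (φ '' A))ᗮ) : ∀ i ∈ A, inner ℝ (φ i) s = 0 := fun i hi =>
  (Submodule.mem_orthogonal _ _).1 hs _ (Submodule.subset_span ⟨i, hi, rfl⟩)

/-- For a greedy ordering, sequential representations in which a given dominating set is linearly
independent exist in every sufficiently large dimension. -/
theorem seqRep_linearIndepOn_nonempty (hW : ∀ j, ∀ i ∈ W j, i < j)
    (hg : ∀ j : Fin n, Dominates W j (W j)) (m : ℕ) (hm : m ≤ n) (d : ℕ) (A : Finset (Fin n))
    (hA : Dominates W m A) (hd : A.card ≤ d) :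
    (seqRep W (EuclideanSpace ℝ (Fin d)) m ∩
      {φ | LinearIndepOn ℝ φ (A : Set (Fin n))}).Nonempty := by
  classical
  induction m generalizing d A with
  | zero =>
    have : A = ∅ := Finset.eq_empty_of_forall_notMem fun a ha => by
      have := hA.lt a ha
      omega
    subst this
    exact ⟨0, fun i hi => absurd hi (by omega), by simp⟩
  | succ m ih =>
    have ih := ih (by omega)
    let k : Fin n := ⟨m, hm⟩
    have hk := hg k
    have hkA : (W k).card ≤ (A.filter fun a => a < k).card := hA.card_le k (Nat.lt_succ_self m)
    have herase : A.filter (fun a => a < k) = A.erase k := by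
      ext a
      simp only [Finset.mem_filter, Finset.mem_erase, Fin.lt_def, ne_eq, Fin.ext_iff, k]
      constructor
      · rintro ⟨h1, h2⟩
        exact ⟨h2.ne, h1⟩
      · rintro ⟨h1, h2⟩
        exact ⟨h2, by have := hA.lt a h2; omega⟩
    have hA' : Dominates W m (A.erase k) := by
      refine ⟨fun a ha => ?_, fun i hi => ?_⟩
      · rw [← herase] at ha
        exact (Finset.mem_filter.1 ha).2
      · refine (hA.card_le i (by omega)).trans (Finset.card_le_card fun a ha => ?_)
        obtain ⟨h1, h2⟩ := Finset.mem_filter.1 ha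
        refine Finset.mem_filter.2 ⟨Finset.mem_erase.2 ⟨fun h => ?_, h1⟩, h2⟩
        subst h
        exact absurd (Fin.lt_def.1 h2) (by simp only [k]; omega)
    rw [herase] at hkA
    by_cases hmem : k ∈ A
    · have hcard := Finset.card_erase_add_one hmem
      obtain ⟨φ, hφ, hB, hGA⟩ := seqRep_inter_nonempty hW (isGenericSet_gramIndep (W k) (A.erase k))
        (isGenericSet_linearIndepOn (A.erase k))
        (gramIndep_nonempty_of_forall hW ih hA' hk hkA (d := d) (by omega))
        (ih d _ hA' (by omega))
      obtain ⟨s, hs, hsA⟩ := GramIndep.exists_notMem_span hB (by omega)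
      refine ⟨Function.update φ k s, update_mem_seqRep hW hφ hB.1
        (inner_eq_zero_of_mem_orthogonal_span hs), ?_⟩
      have hcongr : ∀ i ∈ (A.erase k : Set (Fin n)), Function.update φ k s i = φ i :=
        fun i hi => Function.update_of_ne (Finset.mem_erase.1 (Finset.mem_coe.1 hi)).1 _ _
      rw [← Finset.insert_erase hmem, Finset.coe_insert]
      change LinearIndepOn ℝ _ _
      rw [linearIndepOn_insert (by simp), linearIndepOn_congr hcongr,
        Set.image_congr hcongr, Function.update_self]
      exact ⟨hGA, hsA⟩
    · rw [Finset.erase_eq_of_notMem hmem] at hA' hkA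
      obtain ⟨φ, hφ, hB, hGA⟩ := seqRep_inter_nonempty hW (isGenericSet_linearIndepOn (W k))
        (isGenericSet_linearIndepOn A) (ih d _ hk (hkA.trans hd)) (ih d _ hA' hd)
      -- The vector at `k` is in neither `A` nor any list considered so far, and representations may
      -- contain zero vectors.
      refine ⟨Function.update φ k 0, update_mem_seqRep hW hφ hB (by simp), ?_⟩
      have hcongr : ∀ i ∈ (A : Set (Fin n)),
          Function.update φ k (0 : EuclideanSpace ℝ (Fin d)) i = φ i := fun i hi =>
        Function.update_of_ne (fun h : i = k => hmem (h ▸ Finset.mem_coe.1 hi)) _ _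
      change LinearIndepOn ℝ _ _
      rw [linearIndepOn_congr hcongr]
      exact hGA

end Existence

/-! ### From one example to almost every outcome -/

section Transfer

variable {V : Type*} {n d : ℕ} {G : SimpleGraph V} {v : Fin n ≃ V}

theorem measurable_past (m : Fin n) : Measurable (past (d := d) m) :=
  measurable_pi_lambda _ fun i => measurable_pi_apply (i : Fin n)

/-- Disintegration: the joint law of the past and the next vector is the law of the past composed
with the conditional kernel. -/
theorem ae_notMem_of_condDistrib (P : Measure (Fin n → EuclideanSpace ℝ (Fin d)))
    [IsProbabilityMeasure P] (m : Fin n)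
    {N : Set ((Set.Iio m → EuclideanSpace ℝ (Fin d)) × EuclideanSpace ℝ (Fin d))}
    (hN : MeasurableSet N)
    (h : ∀ᵐ φ ∂P, condDistrib (fun ψ => ψ m) (past m) P (past m φ) {p | (past m φ, p) ∈ N} = 0) :
    ∀ᵐ φ ∂P, (past m φ, φ m) ∉ N := by
  have hm : Measurable fun ψ : Fin n → EuclideanSpace ℝ (Fin d) => ψ m := measurable_pi_apply m
  have hmp := (measurable_past (d := d) m).prodMk hm
  have h1 : ∀ᵐ x ∂(P.map (past m)).compProd (condDistrib (fun ψ => ψ m) (past m) P), x ∉ N := by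
    rw [Measure.ae_compProd_iff (p := fun x => x ∉ N) hN.compl]
    rw [ae_map_iff (measurable_past m).aemeasurable]
    · filter_upwards [h] with φ hφ
      rw [ae_iff]
      simpa using hφ
    · have := Kernel.measurable_kernel_prodMk_left
        (κ := condDistrib (fun ψ => ψ m) (past m) P) hN
      convert this (measurableSet_singleton 0) using 1
      ext x
      simp [ae_iff]
      rfl
  rw [compProd_map_condDistrib hm.aemeasurable, ae_map_iff hmp.aemeasurable hN.compl] at h1
  exact h1

/-- The family with the given past, the vector `p` at `m`, and the vectors of `q` after `m`. -/
def glue {E : Type*} (m : Fin n) (x : Set.Iio m → E) (p : E) (q : Fin n → E) : Fin n → E :=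
  fun j => if h : j < m then x ⟨j, h⟩ else if j = m then p else q j

/-- For measurability: "no continuation reaches `C`" is an intersection of closed conditions, so no
projection of a measurable set is involved. -/
theorem isClosed_forall_glue_notMem {m : Fin n} {C : Set (Fin n → EuclideanSpace ℝ (Fin d))}
    (hC : IsOpen C) :
    IsClosed {x : (Set.Iio m → EuclideanSpace ℝ (Fin d)) × EuclideanSpace ℝ (Fin d) |
      ∀ q, glue m x.1 x.2 q ∉ C} := by
  have hcont : ∀ q : Fin n → EuclideanSpace ℝ (Fin d), Continuous
      fun x : (Set.Iio m → EuclideanSpace ℝ (Fin d)) × EuclideanSpace ℝ (Fin d) =>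
        glue m x.1 x.2 q := by
    refine fun q => continuous_pi fun j => ?_
    unfold glue
    split_ifs <;> fun_prop
  have : {x : (Set.Iio m → EuclideanSpace ℝ (Fin d)) × EuclideanSpace ℝ (Fin d) |
      ∀ q, glue m x.1 x.2 q ∉ C} = ⋂ q, (fun x => glue m x.1 x.2 q) ⁻¹' Cᶜ := by
    ext x
    simp
  rw [this]
  exact isClosed_iInter fun q => hC.isClosed_compl.preimage (hcont q)

theorem glue_past_apply {E : Type*} {m : Fin n} {x : Set.Iio m → E} {φ : Fin n → E}
    (hx : ∀ i, x i = φ i) {p : E} (q : Fin n → E) {j : Fin n} (hj : j < m) :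
    glue m x p q j = φ j := by
  rw [glue, dif_pos hj, hx]

theorem glue_eq_update {E : Type*} {m : Fin n} {x : Set.Iio m → E} {χ : Fin n → E}
    (hx : ∀ i, x i = χ i) (p : E) : glue m x p χ = Function.update χ m p := by
  funext j
  rcases lt_trichotomy j m with h | h | h
  · rw [glue, dif_pos h, hx, Function.update_of_ne h.ne]
  · subst h
    simp [glue]
  · rw [glue, dif_neg h.not_gt, if_neg h.ne', Function.update_of_ne h.ne']

theorem IsGenericSet.glue_smul {m : Fin n} {C : Set (Fin n → EuclideanSpace ℝ (Fin d))}
    (hC : IsGenericSet C) {x : Set.Iio m → EuclideanSpace ℝ (Fin d)}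
    {p : EuclideanSpace ℝ (Fin d)} {q : Fin n → EuclideanSpace ℝ (Fin d)} {c : ℝ} (hc : 0 < c)
    (h : glue m x (c • p) q ∈ C) : glue m x p q ∈ C := by
  have := hC.smul_mem (fun j => if j = m then c⁻¹ else 1)
    (fun j => by split_ifs <;> positivity) _ h
  convert this using 1
  funext j
  rcases lt_trichotomy j m with h | h | h
  · simp [glue, h, h.ne]
  · subst h
    simp [glue, smul_smul, inv_mul_cancel₀ hc.ne']
  · simp [glue, h.ne', h.not_gt]

theorem mem_S_iff {φ : Fin n → EuclideanSpace ℝ (Fin d)} {j : Fin n}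
    {x : EuclideanSpace ℝ (Fin d)} : x ∈ S G v φ j ↔ ∀ i ∈ W G v j, inner ℝ (φ i) x = 0 := by
  rw [S, Submodule.mem_orthogonal]
  refine ⟨fun h i hi => h _ (Submodule.subset_span ⟨i, hi, rfl⟩), fun h u hu => ?_⟩
  induction hu using Submodule.span_induction with
  | mem u hu =>
    obtain ⟨i, hi, rfl⟩ := hu
    exact h i hi
  | zero => simp
  | add u v _ _ hu hv => rw [inner_add_left, hu, hv, add_zero]
  | smul c u _ hu => rw [inner_smul_left, hu, mul_zero]

variable {L : Fin n → Finset (Fin n)} {P : Measure (Fin n → EuclideanSpace ℝ (Fin d))}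
  [IsProbabilityMeasure P]

/-- The projected `m`-th vector of `ψ` lies in `S_m` and is a good choice, so the analytic function
defining `C` is not identically zero on `S_m`. The choices of the `m`-th vector with no continuation
in `C` form a closed positive cone with null trace on `S_m`, to which an admissible law gives no
mass. -/
theorem ae_exists_mem_of_projStep (hL : ∀ j, (L j : Set (Fin n)) = W G v j)
    (hP : IsUniformLSS G v P) (m : Fin n) {C : Set (Fin n → EuclideanSpace ℝ (Fin d))}
    (hC : IsGenericSet C) (hm : ∀ᵐ φ ∂P, LinearIndepOn ℝ φ (W G v m))
    (h : ∀ᵐ φ ∂P, ∃ ψ, (∀ j < m, ψ j = φ j) ∧ projStep L m ψ ∈ C) :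
    ∀ᵐ φ ∂P, ∃ ψ, (∀ j ≤ m, ψ j = φ j) ∧ ψ ∈ C := by
  have hN := isClosed_forall_glue_notMem (m := m) hC.isOpen
  have key : ∀ᵐ φ ∂P, (past m φ, φ m) ∉
      {x : (Set.Iio m → EuclideanSpace ℝ (Fin d)) × EuclideanSpace ℝ (Fin d) |
        ∀ q, glue m x.1 x.2 q ∉ C} := by
    refine ae_notMem_of_condDistrib P m hN.measurableSet ?_
    filter_upwards [hP m, hm, h] with φ hφ hφm ⟨ψ, hψ, hψC⟩
    refine (hφ.1 hφm).2.2 _ ?_ ?_ ?_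
    · exact (hN.preimage (Continuous.prodMk_right (past m φ))).measurableSet
    · exact fun c hc p hp q hq => hp q (hC.glue_smul hc hq)
    · have hlt : ∀ j < m, projStep L m ψ j = φ j := fun j hj => by
        rw [projStep, if_neg (Fin.val_ne_of_ne hj.ne), hψ j hj]
      have hmem : projStep L m ψ m ∈ S G v φ m := by
        rw [mem_S_iff]
        intro i hi
        rw [← hψ i hi.1]
        have := inner_scaledProj (fun i : L m => ψ i) (ψ m) ⟨i, by rwa [← Finset.mem_coe, hL m]⟩
        simpa [projStep] using this
      obtain ⟨⟨g, hg, hgC⟩, -⟩ := hC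
      have hup : ∀ p, glue m (past m φ) p (projStep L m ψ) =
          Function.update (projStep L m ψ) m p :=
        glue_eq_update fun i => (hlt i i.2).symm
      have hgu : ContDiff ℝ ω fun u : S G v φ m =>
          g (Function.update (projStep L m ψ) m (u : EuclideanSpace ℝ (Fin d))) := by
        refine hg.comp (contDiff_pi.2 fun j => ?_)
        by_cases hj : j = m
        · subst hj
          simp only [Function.update_self]
          exact (S G v φ j).subtypeL.contDiff
        · simp only [Function.update_of_ne hj]
          exact contDiff_const
      have hae := ae_ne_zero_of_contDiff (Module.finBasis ℝ (S G v φ m)).addHaar hgu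
        (x := ⟨projStep L m ψ m, hmem⟩) (by
          rw [Function.update_eq_self]
          exact (hgC _).1 hψC)
      rw [ae_iff] at hae
      refine measure_mono_null (fun u hu => ?_) hae
      have := hu (projStep L m ψ)
      rw [hup, hgC] at this
      exact this
  filter_upwards [key] with φ hφ
  simp only [not_forall, not_not] at hφ
  obtain ⟨q, hq⟩ := hφ
  refine ⟨_, fun j hj => ?_, hq⟩
  rcases hj.lt_or_eq with h | h
  · exact glue_past_apply (fun _ => rfl) _ h
  · subst h
    simp [glue]

theorem ae_exists_mem (hL : ∀ j, (L j : Set (Fin n)) = W G v j)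
    (hP : IsUniformLSS G v P) {k : ℕ} (hk : k ≤ n)
    {C : Set (Fin n → EuclideanSpace ℝ (Fin d))} (hC : IsGenericSet C)
    (hind : ∀ j : Fin n, (j : ℕ) < k → ∀ᵐ φ ∂P, LinearIndepOn ℝ φ (W G v j))
    (hne : (seqRep L (EuclideanSpace ℝ (Fin d)) k ∩ C).Nonempty) :
    ∀ᵐ φ ∂P, ∃ ψ, (∀ j : Fin n, (j : ℕ) < k → ψ j = φ j) ∧ ψ ∈ C := by
  -- The first `m` vectors are the random ones, and the remaining `r` are still projections of a
  -- free family. At `m = 0` the given example serves; at `m = k` nothing remains to be projected.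
  have key : ∀ m r, m + r = k →
      ∀ᵐ φ ∂P, ∃ ψ, (∀ j : Fin n, (j : ℕ) < m → ψ j = φ j) ∧ projTail L r m ψ ∈ C := by
    intro m
    induction m with
    | zero =>
      intro r hr
      obtain rfl : r = k := by omega
      obtain ⟨φ, hφ, hφC⟩ := hne
      exact Filter.Eventually.of_forall fun _ =>
        ⟨φ, fun j hj => absurd hj (by omega), hC.projTail_mem hφ hφC⟩
    | succ m ih =>
      intro r hr
      have h := ae_exists_mem_of_projStep hL hP ⟨m, by omega⟩
        (hC.preimage_projTail (W := L) r (m + 1)) (hind _ (by simp only; omega))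
        (ih (r + 1) (by omega))
      filter_upwards [h] with φ ⟨ψ, hψ, hψC⟩
      exact ⟨ψ, fun j hj => hψ j (Nat.lt_succ_iff.1 hj), hψC⟩
  exact key k 0 (by omega)

theorem ae_linearIndepOn (hL : ∀ j, (L j : Set (Fin n)) = W G v j)
    (hP : IsUniformLSS G v P) {k : ℕ} (hk : k ≤ n)
    (hind : ∀ j : Fin n, (j : ℕ) < k → ∀ᵐ φ ∂P, LinearIndepOn ℝ φ (W G v j))
    {A : Finset (Fin n)} (hA : ∀ a ∈ A, (a : ℕ) < k)
    (hne : (seqRep L (EuclideanSpace ℝ (Fin d)) k ∩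
      {φ | LinearIndepOn ℝ φ (A : Set (Fin n))}).Nonempty) :
    ∀ᵐ φ ∂P, LinearIndepOn ℝ φ (A : Set (Fin n)) := by
  filter_upwards [ae_exists_mem hL hP hk (isGenericSet_linearIndepOn A) hind hne]
    with φ ⟨ψ, hψ, hψC⟩
  exact (linearIndepOn_congr fun a ha => hψ a (hA a ha)).1 hψC

/-- Almost surely each vector is orthogonal to the vectors of its list. -/
theorem ae_inner_eq_zero (hP : IsUniformLSS G v P) (m : Fin n)
    (hm : ∀ᵐ φ ∂P, LinearIndepOn ℝ φ (W G v m)) :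
    ∀ᵐ φ ∂P, ∀ i ∈ W G v m, inner ℝ (φ i) (φ m) = 0 := by
  let N : Set ((Set.Iio m → EuclideanSpace ℝ (Fin d)) × EuclideanSpace ℝ (Fin d)) :=
    {x | ∃ i : Set.Iio m, (i : Fin n) ∈ W G v m ∧ inner ℝ (x.1 i) x.2 ≠ 0}
  have hN : IsOpen N := by
    have : N = ⋃ i : Set.Iio m, ⋃ _ : (i : Fin n) ∈ W G v m, {x | inner ℝ (x.1 i) x.2 ≠ 0} := by
      ext x
      simp [N]
    rw [this]
    exact isOpen_iUnion fun i => isOpen_iUnion fun _ =>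
      isOpen_ne_fun (Continuous.inner (by fun_prop) (by fun_prop)) continuous_const
  have h := ae_notMem_of_condDistrib P m hN.measurableSet (by
    filter_upwards [hP m, hm] with φ hφ hφm
    refine measure_mono_null (fun p hp => ?_) (ae_iff.1 (hφ.1 hφm).2.1)
    obtain ⟨i, hi, hip⟩ := hp
    exact fun hpS => hip (mem_S_iff.1 hpS i hi))
  filter_upwards [h] with φ hφ i hi
  by_contra hne
  exact hφ ⟨⟨i, hi.1⟩, hi, hne⟩

end Transfer

/-! ### Greedy orders and the sizes of the lists -/

section Lists

variable {V : Type*} {n d : ℕ}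

open Classical in
/-- The list `W_j` as a finset. -/
noncomputable def listFinset (G : SimpleGraph V) (v : Fin n ≃ V) (j : Fin n) : Finset (Fin n) :=
  Finset.univ.filter (· ∈ W G v j)

theorem coe_listFinset (G : SimpleGraph V) (v : Fin n ≃ V) (j : Fin n) :
    (listFinset G v j : Set (Fin n)) = W G v j := by
  ext i
  simp [listFinset]

theorem mem_listFinset {G : SimpleGraph V} {v : Fin n ≃ V} {i j : Fin n} :
    i ∈ listFinset G v j ↔ i < j ∧ ¬ G.Adj (v i) (v j) := by
  rw [← Finset.mem_coe, coe_listFinset]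
  rfl

theorem card_filter_listFinset_add_localDegree (G : SimpleGraph V) (v : Fin n ≃ V) {i j : Fin n}
    (hij : i ≤ j) :
    ((listFinset G v j).filter fun a => a < i).card + localDegree G v i j = i := by
  classical
  have h1 : (listFinset G v j).filter (fun a => a < i) =
      (Finset.Iio i).filter fun a => ¬ G.Adj (v a) (v j) := by
    ext a
    simp only [Finset.mem_filter, mem_listFinset, Finset.mem_Iio]
    exact ⟨fun h => ⟨h.2, h.1.2⟩, fun h => ⟨⟨h.1.trans_le hij, h.2⟩, h.1⟩⟩
  have h2 : localDegree G v i j = ((Finset.Iio i).filter fun a => G.Adj (v a) (v j)).card := by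
    rw [localDegree, ← Set.ncard_coe_finset]
    congr 1
    ext a
    simp
  rw [h1, h2, add_comm, Finset.card_filter_add_card_filter_not, Fin.card_Iio]

theorem filter_listFinset_self (G : SimpleGraph V) (v : Fin n ≃ V) (j : Fin n) :
    ((listFinset G v j).filter fun a => a < j) = listFinset G v j :=
  Finset.filter_true_of_mem fun _ ha => (mem_listFinset.1 ha).1

/-- Among the `i` earlier positions, neighbours and non-neighbours are complementary, so a largest
local degree means fewest non-neighbours. -/
theorem IsGreedyOrdering.card_listFinset_le {G : SimpleGraph V} {v : Fin n ≃ V}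
    (hv : IsGreedyOrdering G v) {i j : Fin n} (hij : i ≤ j) :
    (listFinset G v i).card ≤ ((listFinset G v j).filter fun a => a < i).card := by
  have h1 := card_filter_listFinset_add_localDegree G v (le_refl i)
  have h2 := card_filter_listFinset_add_localDegree G v hij
  have h3 := hv i j hij
  rw [filter_listFinset_self] at h1
  omega

theorem IsGreedyOrdering.dominates {G : SimpleGraph V} {v : Fin n ≃ V}
    (hv : IsGreedyOrdering G v) (j : Fin n) :
    Dominates (listFinset G v) j (listFinset G v j) :=
  ⟨fun _ ha => (mem_listFinset.1 ha).1, fun _ hi => hv.card_listFinset_le (Fin.le_def.2 hi.le)⟩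

theorem Dominates.insert {L : Fin n → Finset (Fin n)} {m : ℕ} {A : Finset (Fin n)}
    (hA : Dominates L m A) {a : Fin n} (ha : (a : ℕ) < m) : Dominates L m (Insert.insert a A) := by
  refine ⟨fun b hb => ?_, fun i hi => (hA.card_le i hi).trans (Finset.card_le_card ?_)⟩
  · rcases Finset.mem_insert.1 hb with rfl | h
    · exact ha
    · exact hA.lt b h
  · exact Finset.filter_subset_filter _ (Finset.subset_insert a A)

theorem localDegree_last [Fintype V] (G : SimpleGraph V) [DecidableRel G.Adj] (v : Fin n ≃ V)
    {l : Fin n} (hl : ∀ i, i ≤ l) : localDegree G v l l = G.degree (v l) := by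
  rw [localDegree, ← G.card_neighborSet_eq_degree, ← Nat.card_eq_fintype_card, Nat.card_coe_set_eq,
    ← Set.ncard_image_of_injective _ v.injective]
  congr 1
  ext x
  simp only [Set.mem_image, SimpleGraph.mem_neighborSet]
  constructor
  · rintro ⟨h, ⟨-, hh⟩, rfl⟩
    exact hh.symm
  · intro hx
    refine ⟨v.symm x, ⟨lt_of_le_of_ne (hl _) ?_, ?_⟩, v.apply_symm_apply x⟩
    · rintro rfl
      simp at hx
    · rw [v.apply_symm_apply]
      exact hx.symm

/-- By domination no list is longer than that of the last vertex, whose length is `n - 1 - deg = d -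
1`. -/
theorem IsGreedyOrdering.card_listFinset_lt [Fintype V] {G : SimpleGraph V} [DecidableRel G.Adj]
    {v : Fin n ≃ V} (hv : IsGreedyOrdering G v) (hn : 0 < n)
    (hd : d = n - G.degree (v ⟨n - 1, Nat.sub_lt hn Nat.one_pos⟩)) (j : Fin n) :
    (listFinset G v j).card < d := by
  have hl : ∀ i : Fin n, i ≤ ⟨n - 1, Nat.sub_lt hn Nat.one_pos⟩ := fun i =>
    Fin.le_def.2 (by simp only; omega)
  have h1 := hv.card_listFinset_le (hl j)
  have h2 := card_filter_listFinset_add_localDegree G v (hl ⟨n - 1, Nat.sub_lt hn Nat.one_pos⟩)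
  have h3 := (Finset.card_filter_le (listFinset G v ⟨n - 1, Nat.sub_lt hn Nat.one_pos⟩)
    fun a => a < j)
  rw [filter_listFinset_self, localDegree_last G v hl] at h2
  simp only at h2
  omega

end Lists

/-! ### Almost sure properties of uniform LSS -/

section AlmostSure

variable {V : Type*} {n d : ℕ} {G : SimpleGraph V} {v : Fin n ≃ V}
  {P : Measure (Fin n → EuclideanSpace ℝ (Fin d))} [IsProbabilityMeasure P]

theorem IsGreedyOrdering.seqRep_nonempty (hv : IsGreedyOrdering G v) {j : Fin n}
    {A : Finset (Fin n)} (hA : Dominates (listFinset G v) j A) (hAd : A.card ≤ d) :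
    (seqRep (listFinset G v) (EuclideanSpace ℝ (Fin d)) j ∩
      {φ | LinearIndepOn ℝ φ (A : Set (Fin n))}).Nonempty :=
  seqRep_linearIndepOn_nonempty (fun _ _ hi => (mem_listFinset.1 hi).1) hv.dominates j j.2.le d A
    hA hAd

/-- Strong induction is needed because the law of an earlier vector is known to be generic only
where its own list is independent. -/
theorem IsGreedyOrdering.ae_linearIndepOn_W (hv : IsGreedyOrdering G v)
    (hd : ∀ j, (listFinset G v j).card < d) (hP : IsUniformLSS G v P) (j : Fin n) :
    ∀ᵐ φ ∂P, LinearIndepOn ℝ φ (W G v j) := by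
  induction j using WellFoundedLT.induction with
  | ind j ih =>
    rw [← coe_listFinset]
    exact ae_linearIndepOn (coe_listFinset G v) hP j.2.le (fun i hi => ih i hi)
      (hv.dominates j).lt (hv.seqRep_nonempty (hv.dominates j) (hd j).le)

theorem IsGreedyOrdering.ae_linearIndepOn_insert (hv : IsGreedyOrdering G v)
    (hd : ∀ j, (listFinset G v j).card < d) (hP : IsUniformLSS G v P) {i j : Fin n}
    (hij : i < j) : ∀ᵐ φ ∂P, LinearIndepOn ℝ φ (insert i (W G v j)) := by
  have hA := (hv.dominates j).insert hij
  rw [← coe_listFinset, ← Finset.coe_insert]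
  exact ae_linearIndepOn (coe_listFinset G v) hP j.2.le
    (fun i _ => hv.ae_linearIndepOn_W hd hP i) hA.lt
    (hv.seqRep_nonempty hA ((Finset.card_insert_le _ _).trans (hd j)))

theorem IsGreedyOrdering.ae_ne_zero (hv : IsGreedyOrdering G v)
    (hd : ∀ j, (listFinset G v j).card < d) (hP : IsUniformLSS G v P) (j : Fin n) :
    ∀ᵐ φ ∂P, φ j ≠ 0 := by
  obtain ⟨φ, hφ, hφj⟩ := hv.seqRep_nonempty (hv.dominates j) (hd j).le
  obtain ⟨s, hs, hs0⟩ := exists_ne_zero_mem_orthogonal φ (hd j)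
  have hφ' := update_mem_seqRep (fun _ _ hi => (mem_listFinset.1 hi).1) hφ hφj
    (inner_eq_zero_of_mem_orthogonal_span hs)
  filter_upwards [ae_exists_mem (coe_listFinset G v) hP j.2 (isGenericSet_ne_zero j)
    (fun i _ => hv.ae_linearIndepOn_W hd hP i) ⟨_, hφ', by simpa using hs0⟩] with χ ⟨ψ, h, hψ⟩
  rw [← h j (Nat.lt_succ_self j)]
  exact hψ

/-- In an example where `W_j` together with `i` is independent, `φ i` is outside the span of `W_j`,
so some vector orthogonal to `W_j` is not orthogonal to `φ i`. Placed at `j`, it gives the required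
example. -/
theorem IsGreedyOrdering.ae_inner_ne_zero (hv : IsGreedyOrdering G v)
    (hd : ∀ j, (listFinset G v j).card < d) (hP : IsUniformLSS G v P) {i j : Fin n}
    (hij : i < j) (hadj : G.Adj (v i) (v j)) : ∀ᵐ φ ∂P, inner ℝ (φ i) (φ j) ≠ 0 := by
  obtain ⟨φ, hφ, hφj⟩ := hv.seqRep_nonempty ((hv.dominates j).insert hij)
    ((Finset.card_insert_le _ _).trans (hd j))
  have hi : i ∉ (listFinset G v j : Set (Fin n)) := fun h =>
    (mem_listFinset.1 (Finset.mem_coe.1 h)).2 hadj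
  change LinearIndepOn ℝ _ _ at hφj
  rw [Finset.coe_insert, linearIndepOn_insert hi] at hφj
  obtain ⟨s, hs, hs0⟩ := exists_mem_orthogonal_inner_ne_zero hφj.2
  have hφ' := update_mem_seqRep (fun _ _ hi => (mem_listFinset.1 hi).1) hφ hφj.1
    (inner_eq_zero_of_mem_orthogonal_span hs)
  filter_upwards [ae_exists_mem (coe_listFinset G v) hP j.2 (isGenericSet_inner_ne_zero i j)
    (fun i _ => hv.ae_linearIndepOn_W hd hP i)
    ⟨_, hφ', by simpa [Function.update_of_ne hij.ne] using hs0⟩] with χ ⟨ψ, h, hψ⟩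
  rw [← h j (Nat.lt_succ_self j), ← h i (Nat.lt_succ_of_lt hij)]
  exact hψ

theorem IsGreedyOrdering.ae_inner_eq_zero_iff (hv : IsGreedyOrdering G v)
    (hd : ∀ j, (listFinset G v j).card < d) (hP : IsUniformLSS G v P) {i j : Fin n}
    (hij : i < j) : ∀ᵐ φ ∂P, inner ℝ (φ i) (φ j) = 0 ↔ ¬ G.Adj (v i) (v j) := by
  by_cases hadj : G.Adj (v i) (v j)
  · filter_upwards [hv.ae_inner_ne_zero hd hP hij hadj] with φ hφ
    simp [hφ, hadj]
  · filter_upwards [ae_inner_eq_zero hP j (hv.ae_linearIndepOn_W hd hP j)] with φ hφ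
    simp [hφ i ⟨hij, hadj⟩, hadj]

end AlmostSure

end UniformLSS

/-! ### The main theorem -/

theorem mainTheorem1 {V : Type*} [Fintype V] (G : SimpleGraph V) [DecidableRel G.Adj]
    (n : ℕ) (hn : 0 < n) (v : Fin n ≃ V) (hv : UniformLSS.IsGreedyOrdering G v)
    (d : ℕ) (hd : d = n - G.degree (v ⟨n - 1, Nat.sub_lt hn Nat.one_pos⟩)) :
    UniformLSS.SucceedsStrongly G v d ∧
    ∀ (P : Measure (Fin n → EuclideanSpace ℝ (Fin d))) [IsProbabilityMeasure P],
      UniformLSS.IsUniformLSS G v P →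
        ∀ᵐ φ ∂P, (∀ j : Fin n, φ j ≠ 0) ∧
          UniformLSS.IsFaithfulOrthogonalRepresentation G (fun x => φ (v.symm x)) := by
  have hcard := fun j => hv.card_listFinset_lt hn hd j
  refine ⟨⟨fun P _ hP => ?_, fun P _ hP i j hij _ => ?_⟩, fun P _ hP => ?_⟩
  · rw [ae_all_iff]
    intro j
    filter_upwards [hv.ae_linearIndepOn_W hcard hP j] with φ hφ
    refine ⟨?_, hφ⟩
    rw [← UniformLSS.coe_listFinset, Set.ncard_coe_finset]
    exact hcard j
  · exact hv.ae_linearIndepOn_insert hcard hP hij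
  · have h : ∀ᵐ φ ∂P, ∀ i j : Fin n, i < j →
        (inner ℝ (φ i) (φ j) = 0 ↔ ¬ G.Adj (v i) (v j)) := by
      simp only [ae_all_iff]
      exact fun i j hij => hv.ae_inner_eq_zero_iff hcard hP hij
    filter_upwards [h, ae_all_iff.2 (hv.ae_ne_zero hcard hP)] with φ hφ hφ0
    refine ⟨hφ0, fun x y hxy => ?_⟩
    rcases lt_or_gt_of_ne fun h => hxy (v.symm.injective h) with h | h
    · simpa using hφ _ _ h
    · simpa [real_inner_comm, G.adj_comm] using hφ _ _ h
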